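/- Let $m\in\tfrac12\mathbb Z_{>0}$ and $s\in\tfrac12\mathbb Z$. For $\tau\in\mathbb C$ with $\operatorname{Im}\tau>0$ write $q^r=e^{2\pi i r\tau}$. For $z,z_1,z_2\in\mathbb C$ and $j\in\tfrac12\mathbb Z$ put $$\Phi^{\pm[m;s]}(\tau,z_1,z_2)=\sum_{n\in\mathbb Z}(\pm1)^n\frac{e^{2\pi i mn(z_1+z_2)+2\pi i s z_1}q^{mn^2+sn}}{1-e^{2\pi i z_1}q^n},\qquad \Theta^{\pm}_{j,m}(\tau,z)=\sum_{n\in\mathbb Z}(\pm1)^n e^{2\pi i mz(n+\frac{j}{2m})}q^{m(n+\frac{j}{2m})^2},$$ $$R^{\pm}_{j,m}(\tau,z)=\sum_{n\in\frac12\mathbb Z,\ n\equiv j\bmod 2m}(\pm1)^{\frac{n-j}{2m}}\Big\{\operatorname{sign}\big(n-\tfrac12-j+2m\big)-E\Big(\big(n-2m\tfrac{\operatorname{Im}z}{\operatorname{Im}\tau}\big)\sqrt{\tfrac{\operatorname{Im}\tau}{m}}\Big)\Big\}e^{-\frac{\pi i n^2}{2m}\tau+2\pi i nz},$$ where $E(x)=2\int_0^x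 e^{-\pi u^2}\,du$ and $n\equiv j\bmod 2m$ means $n-j\in 2m\mathbb Z$. Further put $$\Phi^{\pm[m;s]}_{\mathrm{add}}(\tau,z_1,z_2)=\sum_{j\in s+\mathbb Z,\ s\le j<s+2m}R^{\pm}_{j,m}\big(\tau,\tfrac{z_1-z_2}{2}\big)\,\Theta^{\pm}_{j,m}(\tau,z_1+z_2),\qquad \tilde\Phi^{\pm[m;s]}=\Phi^{\pm[m;s]}-\tfrac12\Phi^{\pm[m;s]}_{\mathrm{add}}.$$ Theorem. For all $\tau,z_1,z_2\in\mathbb C$ with $\operatorname{Im}\tau>0$ and $z_1\notin\mathbb Z+\tau\mathbb Z$ the series for $\Phi^{\pm[m;s]}(\tau,z_1,z_2)$ converges absolutely, the series for $\Theta^\pm_{j,m}(\tau,z)$ and $R^\pm_{j,m}(\tau,z)$ converge absolutely for all $z\in\mathbb C$, and the following identities hold (in each of them all upper signs or all lower signs are taken). (a) If $s,s_1\in\mathbb Z$ and $s',s_1'\in\tfrac12+\mathbb Z$, then $$\tilde\Phi^{+[m;s]}\big(-\tfrac1\tau,\tfrac{z_1}\tau,\tfrac{z_2}\tau\big)=\tau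 e^{\frac{2\pi i m}{\tau}z_1z_2}\,\tilde\Phi^{+[m;s_1]}(\tau,z_1,z_2),$$ $$\tilde\Phi^{-[m;s]}\big(-\tfrac1\tau,\tfrac{z_1}\tau,\tfrac{z_2}\tau\big)=\tau e^{\frac{2\pi i m}{\tau}z_1z_2}\,\tilde\Phi^{+[m;s']}(\tau,z_1,z_2),$$ $$\tilde\Phi^{+[m;s']}\big(-\tfrac1\tau,\tfrac{z_1}\tau,\tfrac{z_2}\tau\big)=\tau e^{\frac{2\pi i m}{\tau}z_1z_2}\,\tilde\Phi^{-[m;s]}(\tau,z_1,z_2),$$ $$\tilde\Phi^{-[m;s']}\big(-\tfrac1\tau,\tfrac{z_1}\tau,\tfrac{z_2}\tau\big)=\tau e^{\frac{2\pi i m}{\tau}z_1z_2}\,\tilde\Phi^{-[m;s_1']}(\tau,z_1,z_2).$$ (b) If $s,s'\in\tfrac12\mathbb Z$ are such that $m+s\in\mathbb Z$ and $m+s'\in\tfrac12+\mathbb Z$, then $$\tilde\Phi^{\pm[m;s]}(\tau+1,z_1,z_2)=\tilde\Phi^{\pm[m;s]}(\tau,z_1,z_2),\qquad \tilde\Phi^{\pm[m;s']}(\tau+1,z_1,z_2)=\tilde\Phi^{\mp[m;s']}(\tau,z_1,z_2).$$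 (c) If $s\in\tfrac12\mathbb Z$ and $a,b\in\mathbb Z$ have the same parity, or if $s\in\tfrac12\mathbb Z$, $m\in\mathbb Z$ and $a,b\in\mathbb Z$ are arbitrary, then $$\tilde\Phi^{\pm[m;s]}(\tau,z_1+a\tau,z_2+b\tau)=(\pm1)^a e^{-2\pi i m(bz_1+az_2)}q^{-mab}\,\tilde\Phi^{\pm[m;s]}(\tau,z_1,z_2),$$ $$\tilde\Phi^{\pm[m;s]}(\tau,z_1+a,z_2+b)=e^{2\pi i sa}\,\tilde\Phi^{\pm[m;s]}(\tau,z_1,z_2).$$ (d) If $m\notin\mathbb Z$, $s\in\tfrac12\mathbb Z$ and $a,b\in\mathbb Z$ have different parity, then $$\tilde\Phi^{\pm[m;s]}(\tau,z_1+a\tau,z_2+b\tau)=(\pm1)^a e^{-2\pi i m(bz_1+az_2)}q^{-mab}\,\tilde\Phi^{\pm[m;s+\frac12]}(\tau,z_1,z_2),$$ $$\tilde\Phi^{\pm[m;s]}(\tau,z_1+a,z_2+b)=e^{2\pi i sa}\,\tilde\Phi^{\mp[m;s]}(\tau,z_1,z_2).$$ -/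

import Mathlib

noncomputable section

namespace MockTheta

/-- `x ∈ ℤ`, for a real number `x`. -/
def IsInt (x : ℝ) : Prop := ∃ k : ℤ, x = k

/-- `x ∈ ½ + ℤ`, for a real number `x`. -/
def IsHalfOdd (x : ℝ) : Prop := ∃ k : ℤ, x = 1 / 2 + k

/-- `x ∈ ½ℤ`, for a real number `x`. -/
def IsHalfInt (x : ℝ) : Prop := ∃ k : ℤ, x = k / 2

/-- The sign `(±1)^n` as a complex number. The choice of sign `±` is an element `ε` of
`ℤˣ = {1, -1}`. -/
def signPow (ε : ℤˣ) (n : ℤ) : ℂ := (((ε ^ n : ℤˣ) : ℤ) : ℂ)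

/-- `e(x) = exp (2πi x)`. In particular `q ^ r = e (r τ)` for real `r`. -/
def e (x : ℂ) : ℂ := Complex.exp (2 * Real.pi * Complex.I * x)

/-- The `n`-th term of the signed theta series. -/
def thetaTerm (ε : ℤˣ) (j m : ℝ) (τ z : ℂ) (n : ℤ) : ℂ :=
  signPow ε n * e (m * z * (n + j / (2 * m))) * e (m * (n + j / (2 * m)) ^ 2 * τ)

/-- The signed Jacobi form `Θ^±_{j,m}(τ, z)`. -/
def Theta (ε : ℤˣ) (j m : ℝ) (τ z : ℂ) : ℂ := ∑' n : ℤ, thetaTerm ε j m τ z n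

/-- The `n`-th term of the signed mock theta series. -/
def phiTerm (ε : ℤˣ) (m s : ℝ) (τ z₁ z₂ : ℂ) (n : ℤ) : ℂ :=
  signPow ε n * (e (m * n * (z₁ + z₂) + s * z₁) * e ((m * (n : ℂ) ^ 2 + s * n) * τ)) /
    (1 - e z₁ * e (n * τ))

/-- The signed mock theta function `Φ^{±[m;s]}(τ, z₁, z₂)`. It is meromorphic; its poles are on
the hyperplanes `z₁ = p + r τ`, with `p, r ∈ ℤ`. -/
def Phi (ε : ℤˣ) (m s : ℝ) (τ z₁ z₂ : ℂ) : ℂ := ∑' n : ℤ, phiTerm ε m s τ z₁ z₂ n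

/-- `E(x) = 2 ∫₀ˣ exp (-π u²) du`. -/
def E (x : ℝ) : ℝ := 2 * ∫ u in (0 : ℝ)..x, Real.exp (-Real.pi * u ^ 2)

/-- `ψ_{m,n}(τ, z) = (n - 2m Im z / Im τ) √(Im τ / m)`. -/
def psi (m n : ℝ) (τ z : ℂ) : ℝ :=
  (n - 2 * m * (z.im / τ.im)) * Real.sqrt (τ.im / m)

/-- The term of index `n = j + 2mk` in the series of `R^±_{j,m}`; here `(n - j) / (2m) = k`. -/
def RTerm (ε : ℤˣ) (j m : ℝ) (τ z : ℂ) (k : ℤ) : ℂ :=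
  let n : ℝ := j + 2 * m * k
  signPow ε k * ((Real.sign (n - 1 / 2 - j + 2 * m) - E (psi m n τ z) : ℝ) : ℂ) *
    Complex.exp (-(Real.pi * Complex.I * n ^ 2 / (2 * m)) * τ + 2 * Real.pi * Complex.I * n * z)

/-- The real analytic function `R^±_{j,m}(τ, z)`: a sum over all `n ≡ j mod 2m`, which are the
numbers `n = j + 2mk` with `k ∈ ℤ`. -/
def R (ε : ℤˣ) (j m : ℝ) (τ z : ℂ) : ℂ := ∑' k : ℤ, RTerm ε j m τ z k

/-- The signed modifier `Φ^{±[m;s]}_add`: a sum over all `j ∈ s + ℤ` with `s ≤ j < s + 2m`, which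
are the numbers `j = s + k` with `k` a natural number, `k < 2m`. -/
def PhiAdd (ε : ℤˣ) (m s : ℝ) (τ z₁ z₂ : ℂ) : ℂ :=
  ∑ k ∈ Finset.range ⌈2 * m⌉₊,
    R ε (s + k) m τ ((z₁ - z₂) / 2) * Theta ε (s + k) m τ (z₁ + z₂)

/-- The modified signed mock theta function `Φ̃^{±[m;s]} = Φ^{±[m;s]} - ½ Φ^{±[m;s]}_add`. -/
def PhiMod (ε : ℤˣ) (m s : ℝ) (τ z₁ z₂ : ℂ) : ℂ :=
  Phi ε m s τ z₁ z₂ - 1 / 2 * PhiAdd ε m s τ z₁ z₂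

end MockTheta

end

open Complex Filter Topology MeasureTheory

namespace MockTheta

/-! The modified function is, up to the factor `-1/(2πi)`, an absolutely convergent sum over the
lattice `ℤτ + ℤ`. The term at `(n, p)` has denominator `X = z₁ + nτ + p`, a numerator of modulus
`C·exp(-πm|X|²/Im τ)` with `C` independent of `(n, p)`, and the factors `ε^n` and `e(-sp)`. This is
`PhiMod_eq_tsum_latticeTerm`. Once it is known, every identity is a relabelling of the lattice:
inversion is `(n, p) ↦ (p, -n)`, `τ ↦ τ + 1` is `(n, p) ↦ (n, n + p)`, and elliptic shifts translate
`n` or `p`. Since `2s` is an integer, `e(-sp)` is `1` or `(-1)^p`, so each relabelling merely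
permutes or multiplies signs in `n` and `p`. Because `2m` is an integer, the leftover phases are
trivial or again such signs.

The expansion is proved row by row. For fixed `n` the sum over `p` is a Gaussian divided by `z + p`.
Multiplying by `1 - e z` turns the denominator into an integral over `t ∈ [0, 1]`, Poisson summation
applies under the integral, and the integrated Gaussians are differences of consecutive values of
`E`. Summation by parts against the jump of the sign at `0` then yields `1/(1 - e z)`, the term of
`Φ`, minus half a series in `sign - E` (`tsum_e_mul_gauss_div`). Splitting the index of that series
modulo `2m` and summing over the rows factors it into products `R · Θ` (`hasSum_modifierTerm`). -/

/-! ### The exponential `e` and sign characters -/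

theorem e_add (x y : ℂ) : e (x + y) = e x * e y := by
  simp only [e, mul_add, Complex.exp_add]

theorem e_zero : e 0 = 1 := by simp [e]

theorem e_int (k : ℤ) : e k = 1 := by
  rw [e, Complex.exp_eq_one_iff]
  exact ⟨k, by ring⟩

theorem e_eq_of_eq_add_int {x y : ℂ} (k : ℤ) (h : x = y + k) : e x = e y := by
  rw [h, e_add, e_int, mul_one]

theorem norm_e (x : ℂ) : ‖e x‖ = Real.exp (-(2 * Real.pi * x.im)) := by
  rw [e, Complex.norm_exp]
  congr 1
  simp [mul_assoc]

theorem e_eq_one_iff (x : ℂ) : e x = 1 ↔ ∃ k : ℤ, x = k := by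
  rw [e, Complex.exp_eq_one_iff]
  refine exists_congr fun k => ⟨fun h => ?_, fun h => by rw [h]; ring⟩
  have h2 := Complex.two_pi_I_ne_zero
  exact mul_left_cancel₀ h2 (h.trans (mul_comm _ _))

theorem continuous_e : Continuous e := by unfold e; fun_prop

theorem norm_signPow (ε : ℤˣ) (n : ℤ) : ‖signPow ε n‖ = 1 := by
  unfold signPow
  rcases Int.units_eq_one_or (ε ^ n) with h | h <;> simp [h]

theorem signPow_add (ε : ℤˣ) (n k : ℤ) : signPow ε (n + k) = signPow ε n * signPow ε k := by
  simp [signPow, zpow_add]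

theorem signPow_mul (ε δ : ℤˣ) (n : ℤ) : signPow (ε * δ) n = signPow ε n * signPow δ n := by
  simp [signPow, mul_zpow]

theorem signPow_neg (ε : ℤˣ) (n : ℤ) : signPow ε (-n) = signPow ε n := by
  unfold signPow
  rw [zpow_neg, Int.units_inv_eq_self]

theorem signPow_sub (ε : ℤˣ) (n k : ℤ) : signPow ε (n - k) = signPow ε n * signPow ε k := by
  rw [sub_eq_add_neg, signPow_add, signPow_neg]

theorem signPow_mul_self (ε : ℤˣ) (n : ℤ) : signPow ε n * signPow ε n = 1 := by
  rw [← signPow_sub, sub_self, signPow, zpow_zero]; simp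

theorem signPow_one (n : ℤ) : signPow 1 n = 1 := by simp [signPow]

theorem e_half (k : ℤ) : e (k / 2) = signPow (-1) k := by
  have h : ((-1 : ℂ)) = Complex.exp (Real.pi * I) := by simp
  rw [signPow, e]
  have h2 : (((((-1 : ℤˣ) ^ k : ℤˣ) : ℤ)) : ℂ) = (-1 : ℂ) ^ k := by
    rcases Int.even_or_odd k with hk | hk
    · rw [hk.neg_one_zpow, hk.neg_one_zpow]; simp
    · rw [hk.neg_one_zpow, hk.neg_one_zpow]; simp
  rw [h2, h, ← Complex.exp_int_mul]
  congr 1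
  ring

/-- The common majorant of the one-dimensional series; it is the norm of a Jacobi theta series at a
purely imaginary argument. -/
theorem summable_exp_quadratic {A : ℝ} (hA : 0 < A) (B C : ℝ) :
    Summable fun n : ℤ => Real.exp (-A * n ^ 2 + B * n + C) := by
  have h := ((summable_jacobiTheta₂_term_iff (((-B / (2 * Real.pi) : ℝ) : ℂ) * I)
    (((A / Real.pi : ℝ) : ℂ) * I)).2 (by simpa using div_pos hA Real.pi_pos)).norm
  refine (h.mul_left (Real.exp C)).congr fun n => ?_
  rw [norm_jacobiTheta₂_term, ← Real.exp_add]
  congr 1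
  have := Real.pi_ne_zero
  simp only [Complex.im_ofReal_mul, Complex.I_im, mul_one]
  field_simp
  ring

/-! ### The error function and its tails -/

/-- The sign `1` of `k ≥ 0` and `-1` of `k < 0`. -/
def stepSign (k : ℤ) : ℝ := if 0 ≤ k then 1 else -1

theorem continuous_gauss : Continuous fun u : ℝ => Real.exp (-Real.pi * u ^ 2) := by fun_prop

theorem integrable_gauss : Integrable fun u : ℝ => Real.exp (-Real.pi * u ^ 2) :=
  integrable_exp_neg_mul_sq Real.pi_pos

theorem integral_gauss_Ioi : ∫ u in Set.Ioi (0 : ℝ), Real.exp (-Real.pi * u ^ 2) = 1 / 2 := by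
  rw [integral_gaussian_Ioi, div_self Real.pi_ne_zero, Real.sqrt_one]

theorem E_sub (x y : ℝ) : E y - E x = 2 * ∫ u in x..y, Real.exp (-Real.pi * u ^ 2) := by
  have h := intervalIntegral.integral_interval_sub_left (μ := volume)
    (continuous_gauss.intervalIntegrable 0 y) (continuous_gauss.intervalIntegrable 0 x)
  rw [E, E, ← mul_sub, h]

theorem E_neg (x : ℝ) : E (-x) = -E x := by
  have h := intervalIntegral.integral_comp_neg (a := 0) (b := x)
    fun u : ℝ => Real.exp (-Real.pi * u ^ 2)
  simp only [neg_sq, neg_zero] at h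
  rw [E, E, h, intervalIntegral.integral_symm]
  ring

theorem one_sub_E (x : ℝ) :
    1 - E x = 2 * ∫ u in Set.Ioi x, Real.exp (-Real.pi * u ^ 2) := by
  have h := intervalIntegral.integral_Ioi_sub_Ioi' (a := 0) (b := x)
    integrable_gauss.integrableOn integrable_gauss.integrableOn
  rw [integral_gauss_Ioi] at h
  rw [E, ← h]
  ring

theorem one_sub_E_nonneg (x : ℝ) : 0 ≤ 1 - E x := by
  rw [one_sub_E]
  have : 0 ≤ ∫ u in Set.Ioi x, Real.exp (-Real.pi * u ^ 2) :=
    integral_nonneg fun u => (Real.exp_pos _).le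
  linarith

theorem one_add_E_nonneg (x : ℝ) : 0 ≤ 1 + E x := by
  have := one_sub_E_nonneg (-x)
  rw [E_neg] at this
  linarith

/-- Translate the tail to start at `0` and use `(u + x)² ≥ u² + x²` for `u, x ≥ 0`. -/
theorem one_sub_E_le {x : ℝ} (hx : 0 ≤ x) : 1 - E x ≤ Real.exp (-Real.pi * x ^ 2) := by
  have h : ∫ u in Set.Ioi x, Real.exp (-Real.pi * u ^ 2)
      = ∫ u in Set.Ioi (0 : ℝ), Real.exp (-Real.pi * (u + x) ^ 2) := by
    have := (measurePreserving_add_right volume x).setIntegral_preimage_emb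
      (measurableEmbedding_addRight x) (fun u : ℝ => Real.exp (-Real.pi * u ^ 2)) (Set.Ioi x)
    rw [Set.preimage_add_const_Ioi, sub_self] at this
    exact this.symm
  have h2 : ∫ u in Set.Ioi (0 : ℝ), Real.exp (-Real.pi * (u + x) ^ 2)
      ≤ ∫ u in Set.Ioi (0 : ℝ), Real.exp (-Real.pi * x ^ 2) * Real.exp (-Real.pi * u ^ 2) := by
    refine setIntegral_mono_on (integrable_gauss.comp_add_right x).integrableOn
      (integrable_gauss.const_mul _).integrableOn measurableSet_Ioi fun u hu => ?_
    rw [← Real.exp_add]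
    apply Real.exp_le_exp.2
    have hu : (0 : ℝ) < u := hu
    have := mul_nonneg Real.pi_pos.le (mul_nonneg hu.le hx)
    nlinarith
  rw [integral_const_mul, integral_gauss_Ioi] at h2
  rw [one_sub_E, h]
  linarith

/-- If `l` and `l - b` have the same sign, this is the Gaussian tail bound. Otherwise `l` lies
between `0` and `b`, so `(l - b)² ≤ b²`, and the factor `exp(πcb²)` makes the right side at least
the trivial bound `2`. -/
theorem abs_stepSign_sub_E_le {c : ℝ} (hc : 0 < c) (b : ℝ) (l : ℤ) :
    |stepSign l - E ((l - b) * √c)| ≤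
      2 * Real.exp (Real.pi * c * b ^ 2) * Real.exp (-(Real.pi * c * (l - b) ^ 2)) := by
  have hs := Real.sqrt_nonneg c
  have hsq : ((l - b) * √c) ^ 2 = c * (l - b) ^ 2 := by
    rw [mul_pow, Real.sq_sqrt hc.le]; ring
  have hpc : 0 < Real.pi * c := mul_pos Real.pi_pos hc
  have h1 : 1 ≤ Real.exp (Real.pi * c * b ^ 2) := Real.one_le_exp (by positivity)
  have hpos := Real.exp_pos (-(Real.pi * c * (l - b) ^ 2))
  have key : ∀ x : ℝ, 0 ≤ x → x ^ 2 = c * (l - b) ^ 2 → 1 - E x ≤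
      2 * Real.exp (Real.pi * c * b ^ 2) * Real.exp (-(Real.pi * c * (l - b) ^ 2)) := by
    intro x hx hx2
    refine (one_sub_E_le hx).trans ?_
    have h3 : -Real.pi * x ^ 2 = -(Real.pi * c * (l - b) ^ 2) := by rw [hx2]; ring
    rw [h3]
    exact le_mul_of_one_le_left hpos.le (by linarith)
  have key2 : (l - b) ^ 2 ≤ b ^ 2 → 2 ≤
      2 * Real.exp (Real.pi * c * b ^ 2) * Real.exp (-(Real.pi * c * (l - b) ^ 2)) := by
    intro h
    rw [mul_assoc, ← Real.exp_add]
    have : 1 ≤ Real.exp (Real.pi * c * b ^ 2 + -(Real.pi * c * (l - b) ^ 2)) :=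
      Real.one_le_exp (by nlinarith)
    linarith
  have e1 := one_sub_E_nonneg ((l - b) * √c)
  have e2 := one_add_E_nonneg ((l - b) * √c)
  unfold stepSign
  split_ifs with hl
  · rw [abs_of_nonneg e1]
    have hl' : (0 : ℝ) ≤ l := by exact_mod_cast hl
    by_cases h : 0 ≤ (l : ℝ) - b
    · exact key _ (mul_nonneg h hs) hsq
    · refine le_trans (by linarith) (key2 (by nlinarith))
  · have hl' : (l : ℝ) < 0 := by exact_mod_cast not_le.1 hl
    rw [abs_of_nonpos (by linarith)]
    by_cases h : (l : ℝ) - b ≤ 0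
    · have := key (-((l - b) * √c)) (by nlinarith) (by rw [neg_sq, hsq])
      rw [E_neg] at this
      linarith
    · refine le_trans (by linarith) (key2 (by nlinarith))

theorem summable_e_mul_stepSign_sub_E {c : ℝ} (hc : 0 < c) (b s : ℝ) (z : ℂ) :
    Summable fun l : ℤ => e ((l + s) * z) * ((stepSign l - E ((l - b) * √c) : ℝ) : ℂ) := by
  have hpc : 0 < Real.pi * c := mul_pos Real.pi_pos hc
  refine Summable.of_norm_bounded (((summable_exp_quadratic hpc
    (2 * Real.pi * c * b - 2 * Real.pi * z.im)
    (-(2 * Real.pi * s * z.im) - Real.pi * c * b ^ 2)).mul_left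
    (2 * Real.exp (Real.pi * c * b ^ 2)))) fun l => ?_
  rw [norm_mul, norm_e, Complex.norm_real, Real.norm_eq_abs]
  refine (mul_le_mul_of_nonneg_left (abs_stepSign_sub_E_le hc b l) (Real.exp_pos _).le).trans
    (le_of_eq ?_)
  rw [mul_left_comm, ← Real.exp_add]
  congr 2
  have : (((l : ℂ) + s) * z).im = (l + s) * z.im := by simp
  rw [this]
  ring

/-! ### Poisson summation and the sum of a Gaussian over `z + p` -/

/-- Poisson summation for a shifted Gaussian. -/
theorem tsum_e_mul_gauss {c : ℝ} (hc : 0 < c) (b : ℝ) (z : ℂ) :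
    ∑' p : ℤ, e (b * (z + p)) * cexp (-(Real.pi * (z + p) ^ 2 / c)) =
      √c * ∑' l : ℤ, e (l * z) * cexp (-(Real.pi * c * (l - b) ^ 2)) := by
  have hc0 : (c : ℂ) ≠ 0 := by exact_mod_cast hc.ne'
  have hpi : (Real.pi : ℂ) ≠ 0 := by exact_mod_cast Real.pi_ne_zero
  -- Expanding `(z + p)²` shows that the left side is a theta series in `p` with this elliptic
  -- argument and modulus `I / c`.
  set ζ : ℂ := b + I * z / c with hζ
  have h := jacobiTheta₂_functional_equation ζ (I / c)
  have h1 : -I * (I / c) = ((c⁻¹ : ℝ) : ℂ) := by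
    rw [ofReal_inv]; field_simp; simp
  have h2 : (1 : ℂ) / (((c⁻¹ : ℝ) : ℂ) ^ (1 / 2 : ℂ)) = (√c : ℝ) := by
    have : (1 / 2 : ℂ) = ((1 / 2 : ℝ) : ℂ) := by push_cast; rfl
    rw [this, ← ofReal_cpow (by positivity), ← Real.sqrt_eq_rpow, Real.sqrt_inv]
    push_cast
    simp
  rw [h1, h2] at h
  have hL : ∑' p : ℤ, e (b * (z + p)) * cexp (-(Real.pi * (z + p) ^ 2 / c)) =
      cexp (2 * Real.pi * I * b * z - Real.pi * z ^ 2 / c) * jacobiTheta₂ ζ (I / c) := by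
    rw [jacobiTheta₂, ← tsum_mul_left]
    refine tsum_congr fun p => ?_
    rw [e, jacobiTheta₂_term, ← Complex.exp_add, ← Complex.exp_add]
    congr 1
    rw [hζ]
    field_simp
    ring_nf
    simp only [I_sq]
    ring
  rw [hL, h, jacobiTheta₂, mul_assoc (√c : ℂ), mul_left_comm _ (√c : ℂ)]
  congr 1
  rw [← tsum_mul_left, ← tsum_mul_left]
  refine tsum_congr fun l => ?_
  rw [e, jacobiTheta₂_term, ← Complex.exp_add, ← Complex.exp_add, ← Complex.exp_add]
  congr 1
  have hI : I ≠ 0 := I_ne_zero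
  have e1 : ζ / (I / c) = z - I * b * c := by
    rw [hζ]; field_simp; ring_nf; simp only [I_sq]; ring
  have e2 : -Real.pi * I * ζ ^ 2 / (I / c) = -Real.pi * I * ((z - I * b * c) * ζ) := by
    rw [← e1]; ring
  have e3 : (-1 : ℂ) / (I / c) = I * c := by
    field_simp; simp
  rw [e1, e3, e2, hζ]
  field_simp
  ring_nf
  simp only [I_sq, show I ^ 3 = -I by rw [pow_succ, I_sq]; ring]
  ring

/-- This produces the factor `X` that cancels the denominator `z + p`. -/
theorem one_sub_e_eq_integral (X : ℂ) :
    1 - e X = X * (-(2 * Real.pi * I) * ∫ t in (0 : ℝ)..1, e (t * X)) := by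
  by_cases hX : X = 0
  · simp [hX, e_zero]
  have h := integral_exp_mul_complex (a := 0) (b := 1)
    (mul_ne_zero Complex.two_pi_I_ne_zero hX)
  have h2 : ∫ t in (0 : ℝ)..1, e (t * X) =
      ∫ t in (0 : ℝ)..1, cexp (2 * Real.pi * I * X * t) := by
    refine intervalIntegral.integral_congr fun t _ => ?_
    simp only [e]
    congr 1
    ring
  rw [h2, h]
  have := Complex.two_pi_I_ne_zero
  simp only [e, ofReal_one, mul_one, ofReal_zero, mul_zero, Complex.exp_zero]
  field_simp
  ring

/-- Moving the centre of the Gaussian from `b` to `b + 1` sweeps out exactly the interval between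
the two arguments of `E`. -/
theorem E_sub_eq_integral {c : ℝ} (hc : 0 < c) (b x : ℝ) :
    ((E ((x - b) * √c) - E ((x - 1 - b) * √c) : ℝ) : ℂ) =
      2 * √c * ∫ t in (0 : ℝ)..1, cexp (-(Real.pi * c * (x - (b + t : ℝ)) ^ 2)) := by
  have hs : √c ≠ 0 := (Real.sqrt_pos.2 hc).ne'
  have h := intervalIntegral.integral_comp_sub_mul (a := 0) (b := 1)
    (fun u : ℝ => Real.exp (-Real.pi * u ^ 2)) hs ((x - b) * √c)
  have h1 : ∫ t in (0 : ℝ)..1, cexp (-(Real.pi * c * (x - (b + t : ℝ)) ^ 2)) =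
      ((∫ t in (0 : ℝ)..1, Real.exp (-Real.pi * ((x - b) * √c - √c * t) ^ 2) : ℝ) : ℂ) := by
    rw [← intervalIntegral.integral_ofReal]
    refine intervalIntegral.integral_congr fun t _ => ?_
    have : -(Real.pi * c * (x - (b + t : ℝ)) ^ 2) =
        -Real.pi * ((x - b) * √c - √c * t) ^ 2 := by
      have := Real.sq_sqrt hc.le
      linear_combination (Real.pi * (x - (b + t)) ^ 2) * this
    simp only [← this]
    push_cast
    rfl
  rw [h1, h, E_sub]
  push_cast
  have h3 : (x - 1 - b) * √c = (x - b) * √c - √c * 1 := by ring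
  have h4 : (√c : ℂ) ≠ 0 := by exact_mod_cast hs
  rw [h3, mul_zero, sub_zero, smul_eq_mul]
  push_cast
  field_simp

theorem summable_norm_e_mul_gauss {c : ℝ} (hc : 0 < c) (b : ℝ) (z : ℂ) :
    Summable fun p : ℤ => ‖e (b * (z + p)) * cexp (-(Real.pi * (z + p) ^ 2 / c))‖ := by
  refine (summable_exp_quadratic (div_pos Real.pi_pos hc) (-(2 * Real.pi * z.re / c))
    (-(2 * Real.pi * b * z.im) - Real.pi * (z.re ^ 2 - z.im ^ 2) / c)).congr fun p => ?_
  rw [norm_mul, norm_e, Complex.norm_exp, ← Real.exp_add]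
  congr 1
  have h : (-(Real.pi * (z + p) ^ 2 / c)).re =
      -(Real.pi * ((z.re + p) ^ 2 - z.im ^ 2) / c) := by
    have h0 : (Real.pi * (z + p) ^ 2 / c : ℂ) = ((Real.pi / c : ℝ) : ℂ) * (z + p) ^ 2 := by
      push_cast; ring
    rw [h0, neg_re, re_ofReal_mul, sq, mul_re]
    simp
    ring
  have h' : ((b : ℂ) * (z + p)).im = b * z.im := by simp
  rw [h, h']
  ring

/-- Since `1 - e z = 1 - e (z + p)`, each quotient becomes an integral of the Gaussian with `b`
replaced by `b + t`. Poisson summation is applied for every `t`, and sum and integral are exchanged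
by dominated convergence on both sides. -/
theorem one_sub_e_mul_tsum {c : ℝ} (hc : 0 < c) (b : ℝ) (z : ℂ) (hz : ∀ p : ℤ, z + p ≠ 0) :
    (1 - e z) * ∑' p : ℤ, e (b * (z + p)) * cexp (-(Real.pi * (z + p) ^ 2 / c)) / (z + p) =
      -(Real.pi * I) *
        ∑' l : ℤ, e (l * z) * ((E ((l - b) * √c) - E ((l - 1 - b) * √c) : ℝ) : ℂ) := by
  have hpc : 0 < Real.pi * c := mul_pos Real.pi_pos hc
  have hA := intervalIntegral.hasSum_integral_of_dominated_convergence (a := 0) (b := 1)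
    (μ := volume) (ι := ℤ)
    (F := fun p (t : ℝ) => e ((b + t : ℝ) * (z + p)) * cexp (-(Real.pi * (z + p) ^ 2 / c)))
    (f := fun t : ℝ =>
      ∑' p : ℤ, e ((b + t : ℝ) * (z + p)) * cexp (-(Real.pi * (z + p) ^ 2 / c)))
    (fun p _ => Real.exp (2 * Real.pi * |z.im|) *
      ‖e (b * (z + p)) * cexp (-(Real.pi * (z + p) ^ 2 / c))‖)
    (fun p => (Continuous.aestronglyMeasurable (by
      have := continuous_e
      fun_prop))) ?_ ?_ ?_ ?_
  rotate_left
  · intro p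
    refine Eventually.of_forall fun t ht => ?_
    rw [Set.uIoc_of_le zero_le_one] at ht
    rw [norm_mul, norm_mul, ← mul_assoc]
    refine mul_le_mul_of_nonneg_right ?_ (norm_nonneg _)
    rw [norm_e, norm_e, ← Real.exp_add]
    refine Real.exp_le_exp.2 ?_
    rw [im_ofReal_mul, im_ofReal_mul]
    simp only [add_im, intCast_im, add_zero]
    have h1 : -(t * z.im) ≤ |z.im| := by
      have h3 := neg_abs_le (t * z.im)
      rw [abs_mul, abs_of_pos ht.1] at h3
      nlinarith [ht.2, abs_nonneg z.im]
    have := mul_le_mul_of_nonneg_left h1 (by positivity : (0 : ℝ) ≤ 2 * Real.pi)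
    linarith
  · exact Eventually.of_forall fun t _ => (summable_norm_e_mul_gauss hc b z).mul_left _
  · exact intervalIntegrable_const
  · exact Eventually.of_forall fun t _ => (summable_norm_e_mul_gauss hc _ z).of_norm.hasSum
  have hB := intervalIntegral.hasSum_integral_of_dominated_convergence (a := 0) (b := 1)
    (μ := volume) (ι := ℤ)
    (F := fun l (t : ℝ) => e (l * z) * cexp (-(Real.pi * c * (l - (b + t : ℝ)) ^ 2)))
    (f := fun t : ℝ => ∑' l : ℤ, e (l * z) * cexp (-(Real.pi * c * (l - (b + t : ℝ)) ^ 2)))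
    (fun l _ => Real.exp (-(Real.pi * c / 2) * l ^ 2 +
      (Real.pi * c * b - 2 * Real.pi * z.im) * l + (Real.pi * c - Real.pi * c * b ^ 2 / 2)))
    (fun p => (Continuous.aestronglyMeasurable (by fun_prop))) ?_ ?_ ?_ ?_
  rotate_left
  · intro l
    refine Eventually.of_forall fun t ht => ?_
    rw [Set.uIoc_of_le zero_le_one] at ht
    have h : -(Real.pi * c * (l - (b + t : ℝ)) ^ 2 : ℂ) =
        ((-(Real.pi * c * (l - (b + t)) ^ 2) : ℝ) : ℂ) := by push_cast; rfl
    rw [norm_mul, norm_e, h, Complex.norm_exp, ← Real.exp_add, ofReal_re]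
    refine Real.exp_le_exp.2 ?_
    have h' : ((l : ℂ) * z).im = l * z.im := by simp
    rw [h']
    -- The difference of the two sides is `(l - b - 2t)²/2 + 1 - t²`; this makes the majorant
    -- uniform in `t`.
    have h2 : (l - b) ^ 2 / 2 - 1 ≤ (l - (b + t)) ^ 2 := by
      nlinarith [sq_nonneg (l - b - 2 * t), ht.1, ht.2]
    have := mul_le_mul_of_nonneg_left h2 hpc.le
    linarith
  · exact Eventually.of_forall fun t _ => summable_exp_quadratic (by positivity) _ _
  · exact intervalIntegrable_const
  · refine Eventually.of_forall fun t _ => Summable.hasSum (Summable.of_norm_bounded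
      (summable_exp_quadratic hpc (2 * Real.pi * c * (b + t) - 2 * Real.pi * z.im)
        (-(Real.pi * c * (b + t) ^ 2))) fun l => le_of_eq ?_)
    have h : -(Real.pi * c * (l - (b + t : ℝ)) ^ 2 : ℂ) =
        ((-(Real.pi * c * (l - (b + t)) ^ 2) : ℝ) : ℂ) := by push_cast; rfl
    rw [norm_mul, norm_e, h, Complex.norm_exp, ← Real.exp_add, ofReal_re]
    congr 1
    have h' : ((l : ℂ) * z).im = l * z.im := by simp
    rw [h']
    ring
  have hC : ∀ p : ℤ,
      (1 - e z) * (e (b * (z + p)) * cexp (-(Real.pi * (z + p) ^ 2 / c)) / (z + p)) =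
      -(2 * Real.pi * I) *
        ∫ t in (0 : ℝ)..1, e ((b + t : ℝ) * (z + p)) * cexp (-(Real.pi * (z + p) ^ 2 / c)) := by
    intro p
    have h1 : 1 - e z = 1 - e (z + p) := by rw [e_eq_of_eq_add_int p rfl]
    have h2 : ∀ t : ℝ, e ((b + t : ℝ) * (z + p)) * cexp (-(Real.pi * (z + p) ^ 2 / c)) =
        (e (b * (z + p)) * cexp (-(Real.pi * (z + p) ^ 2 / c))) * e (t * (z + p)) := by
      intro t
      rw [ofReal_add, add_mul, e_add]
      ring
    simp only [h2]
    rw [intervalIntegral.integral_const_mul, h1, one_sub_e_eq_integral]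
    have := hz p
    field_simp
  have hD : ∀ l : ℤ, e (l * z) * ((E ((l - b) * √c) - E ((l - 1 - b) * √c) : ℝ) : ℂ) =
      2 * √c * ∫ t in (0 : ℝ)..1, e (l * z) * cexp (-(Real.pi * c * (l - (b + t : ℝ)) ^ 2)) := by
    intro l
    have := E_sub_eq_integral hc b l
    rw [ofReal_intCast] at this
    rw [this, intervalIntegral.integral_const_mul]
    ring
  rw [← tsum_mul_left, tsum_congr hC, tsum_congr hD, tsum_mul_left, tsum_mul_left,
    hA.tsum_eq, hB.tsum_eq]
  simp only [tsum_e_mul_gauss hc]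
  rw [intervalIntegral.integral_const_mul]
  ring

/-- Summation by parts: multiplying the series in `stepSign - E` by `1 - e z` takes differences of
its coefficients. The differences of `E` are those of `one_sub_e_mul_tsum`, and the step contributes
only its jump `2` at `l = 0`. -/
theorem tsum_e_mul_gauss_div {c : ℝ} (hc : 0 < c) (b : ℝ) (z : ℂ) (hz : ∀ p : ℤ, z + p ≠ 0) :
    -(1 / (2 * Real.pi * I)) *
      ∑' p : ℤ, e (b * (z + p)) * cexp (-(Real.pi * (z + p) ^ 2 / c)) / (z + p) =
    1 / (1 - e z) -
      1 / 2 * ∑' l : ℤ, e (l * z) * ((stepSign l - E ((l - b) * √c) : ℝ) : ℂ) := by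
  have h1 : 1 - e z ≠ 0 := by
    intro h
    obtain ⟨k, hk⟩ := (e_eq_one_iff z).1 (sub_eq_zero.1 h).symm
    exact hz (-k) (by rw [hk]; push_cast; ring)
  have hS : Summable fun l : ℤ => e (l * z) * ((stepSign l - E ((l - b) * √c) : ℝ) : ℂ) := by
    simpa using summable_e_mul_stepSign_sub_E hc b 0 z
  set S := ∑' l : ℤ, e (l * z) * ((stepSign l - E ((l - b) * √c) : ℝ) : ℂ) with hSdef
  have hT : HasSum (fun l : ℤ =>
      e z * (e ((l - 1 : ℤ) * z) * ((stepSign (l - 1) - E (((l - 1 : ℤ) - b) * √c) : ℝ) : ℂ)))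
      (e z * S) :=
    (((Equiv.subRight (1 : ℤ)).hasSum_iff (f := fun l : ℤ =>
      e (l * z) * ((stepSign l - E ((l - b) * √c) : ℝ) : ℂ))).2 hS.hasSum).mul_left _
  have hU : HasSum (fun l : ℤ => if l = 0 then (2 : ℂ) else 0) 2 := hasSum_ite_eq 0 2
  have hV := ((hU.sub hS.hasSum).add hT).tsum_eq
  have hW : ∀ l : ℤ, e (l * z) * ((E ((l - b) * √c) - E ((l - 1 - b) * √c) : ℝ) : ℂ) =
      (if l = 0 then (2 : ℂ) else 0)
        - e (l * z) * ((stepSign l - E ((l - b) * √c) : ℝ) : ℂ)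
        + e z * (e ((l - 1 : ℤ) * z) *
          ((stepSign (l - 1) - E (((l - 1 : ℤ) - b) * √c) : ℝ) : ℂ)) := by
    intro l
    have h2 : e z * e ((l - 1 : ℤ) * z) = e (l * z) := by
      rw [← e_add]; congr 1; push_cast; ring
    have h3 : (if l = 0 then (2 : ℂ) else 0) =
        e (l * z) * ((stepSign l - stepSign (l - 1) : ℝ) : ℂ) := by
      unfold stepSign
      split_ifs with h4 h5 h6 h6 h6 h6 <;> first | omega | skip
      · simp [h4, e_zero]; norm_num
      · simp
      · simp
    rw [← mul_assoc (e z), h2, h3]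
    push_cast
    ring
  have hX := one_sub_e_mul_tsum hc b z hz
  rw [tsum_congr hW, hV, ← hSdef] at hX
  have hpi : (Real.pi : ℂ) ≠ 0 := by exact_mod_cast Real.pi_ne_zero
  have hI := I_ne_zero
  field_simp
  linear_combination -hX

/-! ### Convergence of the defining series -/

theorem summable_thetaTerm {m : ℝ} (hm : 0 < m) {τ : ℂ} (hτ : 0 < τ.im) (ε : ℤˣ) (j : ℝ) (z : ℂ) :
    Summable (thetaTerm ε j m τ z) := by
  refine Summable.of_norm_bounded (summable_exp_quadratic
    (by positivity : 0 < 2 * Real.pi * m * τ.im)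
    (-(2 * Real.pi * m * z.im) - 4 * Real.pi * m * (j / (2 * m)) * τ.im)
    (-(2 * Real.pi * m * z.im * (j / (2 * m))) - 2 * Real.pi * m * (j / (2 * m)) ^ 2 * τ.im))
    fun n => le_of_eq ?_
  have h1 : (m * z * (n + j / (2 * m)) : ℂ) = ((m * (n + j / (2 * m)) : ℝ) : ℂ) * z := by
    push_cast; ring
  have h2 : (m * (n + j / (2 * m)) ^ 2 * τ : ℂ) = ((m * (n + j / (2 * m)) ^ 2 : ℝ) : ℂ) * τ := by
    push_cast; ring
  rw [thetaTerm, h1, h2, norm_mul, norm_mul, norm_signPow, norm_e, norm_e, one_mul, ← Real.exp_add,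
    im_ofReal_mul, im_ofReal_mul]
  congr 1
  ring

/-- The argument equals `N(k + 1) - 1/2`; the shift by `1/2` makes it negative, not zero, at `k =
-1`. -/
theorem sign_eq_stepSign {m : ℝ} {N : ℕ} (hN0 : 0 < N) (hN : 2 * m = N) (j : ℝ) (k : ℤ) :
    Real.sign (j + 2 * m * k - 1 / 2 - j + 2 * m) = stepSign k := by
  have h : j + 2 * m * k - 1 / 2 - j + 2 * m = ((N * (k + 1) : ℤ) : ℝ) - 1 / 2 := by
    push_cast; rw [hN]; ring
  rw [h, stepSign]
  split_ifs with hk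
  · have : (1 : ℤ) ≤ N * (k + 1) := by
      have : (1 : ℤ) ≤ N := by exact_mod_cast hN0
      nlinarith
    have : (1 : ℝ) ≤ ((N * (k + 1) : ℤ) : ℝ) := by exact_mod_cast this
    exact Real.sign_of_pos (by linarith)
  · have : (N * (k + 1) : ℤ) ≤ 0 := by
      have : (0 : ℤ) ≤ N := by positivity
      nlinarith
    have : ((N * (k + 1) : ℤ) : ℝ) ≤ 0 := by exact_mod_cast this
    exact Real.sign_of_neg (by linarith)

theorem stepSign_add_mul {N : ℕ} {r : ℕ} (hr : r < N) (k : ℤ) :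
    stepSign (k * N + r) = stepSign k := by
  have h : (0 ≤ (k * N + r : ℤ)) ↔ 0 ≤ k := by
    constructor
    · intro h
      by_contra hk
      have : k * (N : ℤ) ≤ (-1) * N := mul_le_mul_of_nonneg_right (by omega) (by positivity)
      omega
    · intro h
      positivity
  simp only [stepSign, h]

/-- The exponential grows like `exp(2πm Im τ k²)`, but `sign - E` decays like `exp(-4πm Im τ k²)`.
-/
theorem summable_RTerm {m : ℝ} (hm : 0 < m) {N : ℕ} (hN : 2 * m = N) {τ : ℂ} (hτ : 0 < τ.im)
    (ε : ℤˣ) (j : ℝ) (z : ℂ) : Summable (RTerm ε j m τ z) := by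
  have hN0 : 0 < N := by
    have : (0 : ℝ) < N := by linarith
    exact_mod_cast this
  set b : ℝ := z.im / τ.im - j / (2 * m) with hb
  set c : ℝ := 4 * m * τ.im with hc
  have hc0 : 0 < c := by positivity
  have hsqrt : √c = 2 * m * √(τ.im / m) := by
    have : c = (2 * m) ^ 2 * (τ.im / m) := by rw [hc]; field_simp; norm_num
    rw [this, Real.sqrt_mul (by positivity), Real.sqrt_sq (by positivity)]
  refine Summable.of_norm_bounded ((summable_exp_quadratic
    (by positivity : 0 < 2 * Real.pi * m * τ.im)
    (2 * Real.pi * τ.im * j - 4 * Real.pi * m * z.im + 2 * Real.pi * c * b)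
    (Real.pi * j ^ 2 * τ.im / (2 * m) - 2 * Real.pi * j * z.im - Real.pi * c * b ^ 2)).mul_left
    (2 * Real.exp (Real.pi * c * b ^ 2))) fun k => ?_
  have h1 : psi m (j + 2 * m * k) τ z = (k - b) * √c := by
    rw [psi, hsqrt, hb]
    field_simp
    ring
  have h2 : (-(Real.pi * I * (j + 2 * m * k : ℝ) ^ 2 / (2 * m)) * τ
      + 2 * Real.pi * I * (j + 2 * m * k : ℝ) * z : ℂ).re =
      Real.pi * (j + 2 * m * k) ^ 2 / (2 * m) * τ.im - 2 * Real.pi * (j + 2 * m * k) * z.im := by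
    have h3 : (-(Real.pi * I * (j + 2 * m * k : ℝ) ^ 2 / (2 * m)) * τ
        + 2 * Real.pi * I * (j + 2 * m * k : ℝ) * z : ℂ) =
        ((-(Real.pi * (j + 2 * m * k) ^ 2 / (2 * m)) : ℝ) : ℂ) * (I * τ) +
        ((2 * Real.pi * (j + 2 * m * k) : ℝ) : ℂ) * (I * z) := by push_cast; ring
    rw [h3, add_re, re_ofReal_mul, re_ofReal_mul, I_mul_re, I_mul_re]
    ring
  simp only [RTerm]
  rw [norm_mul, norm_mul, norm_signPow, one_mul, Complex.norm_real, Real.norm_eq_abs,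
    Complex.norm_exp, h2, sign_eq_stepSign hN0 hN, h1]
  refine (mul_le_mul_of_nonneg_right (abs_stepSign_sub_E_le hc0 b k) (Real.exp_pos _).le).trans
    (le_of_eq ?_)
  rw [mul_assoc, ← Real.exp_add]
  congr 2
  rw [hc]
  field_simp
  ring

/-- The modulus of `e z * e (n * τ)` tends to `∞` as `n → -∞` and to `0` as `n → ∞`, so it is
eventually at distance at least `1/2` from `1`. -/
theorem norm_inv_one_sub_e_le {τ z : ℂ} (hτ : 0 < τ.im) :
    ∀ᶠ n : ℤ in cofinite, ‖(1 - e z * e (n * τ))⁻¹‖ ≤ 2 := by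
  have hnorm : ∀ n : ℤ, ‖e z * e (n * τ)‖ =
      Real.exp (-(2 * Real.pi * z.im) - 2 * Real.pi * τ.im * n) := by
    intro n
    rw [norm_mul, norm_e, norm_e, ← Real.exp_add]
    congr 1
    have : ((n : ℂ) * τ).im = n * τ.im := by simp
    rw [this]
    ring
  have hpos : 0 < 2 * Real.pi * τ.im := by positivity
  have hlow : ∀ n : ℤ, 1 / 2 ≤ |1 - ‖e z * e (n * τ)‖| → ‖(1 - e z * e (n * τ))⁻¹‖ ≤ 2 := by
    intro n hn
    have h := abs_norm_sub_norm_le (1 : ℂ) (e z * e (n * τ))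
    rw [norm_one] at h
    rw [norm_inv]
    exact (inv_anti₀ (by norm_num) (hn.trans h)).trans (by norm_num)
  rw [Int.cofinite_eq, eventually_sup]
  constructor
  · have h : Tendsto (fun n : ℤ => Real.exp (-(2 * Real.pi * z.im) - 2 * Real.pi * τ.im * n))
        atBot atTop := by
      refine Real.tendsto_exp_atTop.comp (tendsto_atTop_add_const_left _ _ ?_)
      refine tendsto_neg_atBot_atTop.comp ?_
      exact (tendsto_const_mul_atBot_of_pos hpos).2 (tendsto_intCast_atBot_iff.2 tendsto_id)
    filter_upwards [h.eventually_ge_atTop 2] with n hn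
    apply hlow
    rw [hnorm, abs_of_nonpos (by linarith)]
    linarith
  · have h : Tendsto (fun n : ℤ => Real.exp (-(2 * Real.pi * z.im) - 2 * Real.pi * τ.im * n))
        atTop (𝓝 0) := by
      refine Real.tendsto_exp_atBot.comp (tendsto_atBot_add_const_left _ _ ?_)
      refine tendsto_neg_atTop_atBot.comp ?_
      exact (tendsto_const_mul_atTop_of_pos hpos).2 tendsto_intCast_atTop_atTop
    filter_upwards [h.eventually_le_const (by norm_num : (0 : ℝ) < 1 / 2)] with n hn
    apply hlow
    rw [hnorm, abs_of_nonneg (by linarith)]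
    linarith

theorem summable_phiTerm {m : ℝ} (hm : 0 < m) {τ : ℂ} (hτ : 0 < τ.im) (ε : ℤˣ) (s : ℝ)
    (z₁ z₂ : ℂ) : Summable (phiTerm ε m s τ z₁ z₂) := by
  refine Summable.of_norm_bounded_eventually ((summable_exp_quadratic
    (by positivity : 0 < 2 * Real.pi * m * τ.im)
    (-(2 * Real.pi * m * (z₁ + z₂).im) - 2 * Real.pi * s * τ.im)
    (-(2 * Real.pi * s * z₁.im))).mul_left 2) ?_
  filter_upwards [norm_inv_one_sub_e_le (z := z₁) hτ] with n hn
  have h1 : (m * n * (z₁ + z₂) + s * z₁ : ℂ).im = m * n * (z₁ + z₂).im + s * z₁.im := by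
    have : (m * n * (z₁ + z₂) + s * z₁ : ℂ) = ((m * n : ℝ) : ℂ) * (z₁ + z₂) + (s : ℝ) * z₁ := by
      push_cast; ring
    rw [this, Complex.add_im, im_ofReal_mul, im_ofReal_mul]
  have h2 : ((m * (n : ℂ) ^ 2 + s * n) * τ : ℂ).im = (m * n ^ 2 + s * n) * τ.im := by
    have : ((m * (n : ℂ) ^ 2 + s * n) * τ : ℂ) = ((m * n ^ 2 + s * n : ℝ) : ℂ) * τ := by
      push_cast; ring
    rw [this, im_ofReal_mul]
  rw [phiTerm, div_eq_mul_inv, norm_mul, norm_mul, norm_mul, norm_signPow, one_mul, norm_e, norm_e,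
    h1, h2, ← Real.exp_add, mul_comm]
  refine (mul_le_mul_of_nonneg_right hn (Real.exp_pos _).le).trans (le_of_eq ?_)
  congr 2
  ring

/-! ### The lattice series and its absolute convergence -/

/-- The exponent of the term of index `(n, p)` in the expansion of `Φ̃` over the lattice
`ℤτ + ℤ`. -/
noncomputable def latticeExponent (m : ℝ) (τ z₁ z₂ : ℂ) (n p : ℤ) : ℂ :=
  m * n * (z₁ + z₂) + m * n ^ 2 * τ
    + m * ((z₁ - z₂).im / τ.im : ℝ) * (z₁ + n * τ + p)
    + I * m / (2 * τ.im) * (z₁ + n * τ + p) ^ 2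

/-- The term of index `(n, p)` in the expansion of `Φ̃` over the lattice `ℤτ + ℤ`. -/
noncomputable def latticeTerm (ε : ℤˣ) (m s : ℝ) (τ z₁ z₂ : ℂ) (v : ℤ × ℤ) : ℂ :=
  signPow ε v.1 * e (-(s * v.2)) * e (latticeExponent m τ z₁ z₂ v.1 v.2) /
    (z₁ + v.1 * τ + v.2)

/-- The quadratic part alone gives `(Re X)² - (Im X)²`; the other terms of the exponent reverse the
second sign, up to a constant, making the decay Gaussian in both directions. -/
theorem norm_e_latticeExponent (m : ℝ) {τ : ℂ} (hτ : 0 < τ.im) (z₁ z₂ : ℂ) (n p : ℤ) :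
    ‖e (latticeExponent m τ z₁ z₂ n p)‖ =
      Real.exp (-(2 * Real.pi * m * z₁.im * (z₁.im - (z₁ + z₂).im) / τ.im)) *
      Real.exp (-(Real.pi * m / τ.im *
        ((z₁ + n * τ + p).re ^ 2 + (z₁ + n * τ + p).im ^ 2))) := by
  have h : latticeExponent m τ z₁ z₂ n p = ((m * n : ℝ) : ℂ) * (z₁ + z₂)
      + ((m * n ^ 2 : ℝ) : ℂ) * τ + ((m * ((z₁ - z₂).im / τ.im) : ℝ) : ℂ) * (z₁ + n * τ + p)
      + ((m / (2 * τ.im) : ℝ) : ℂ) * (I * (z₁ + n * τ + p) ^ 2) := by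
    rw [latticeExponent]; push_cast; ring
  have h2 : (z₁ + n * τ + p).im = z₁.im + n * τ.im := by simp
  rw [norm_e, ← Real.exp_add, h]
  congr 1
  rw [add_im, add_im, add_im, im_ofReal_mul, im_ofReal_mul, im_ofReal_mul, im_ofReal_mul,
    I_mul_im, sq (z₁ + n * τ + p), mul_re, h2, sub_im, add_im z₁ z₂]
  field_simp
  ring

theorem summable_latticeTerm {m : ℝ} (hm : 0 < m) {τ : ℂ} (hτ : 0 < τ.im) (ε : ℤˣ) (s : ℝ)
    (z₁ z₂ : ℂ) : Summable (latticeTerm ε m s τ z₁ z₂) := by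
  set K₁ : ℝ := 3 + (1 + 3 * τ.re ^ 2) * (2 / τ.im ^ 2) with hK₁
  set K₂ : ℝ := 3 * z₁.re ^ 2 + (1 + 3 * τ.re ^ 2) * (2 * z₁.im ^ 2 / τ.im ^ 2) with hK₂
  have hK₁pos : 0 < K₁ := by positivity
  have hK : ∀ n p : ℤ, (n : ℝ) ^ 2 + p ^ 2 ≤
      K₁ * ((z₁ + n * τ + p).re ^ 2 + (z₁ + n * τ + p).im ^ 2) + K₂ := by
    intro n p
    have hX : (z₁ + n * τ + p).re = z₁.re + n * τ.re + p := by simp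
    have hY : (z₁ + n * τ + p).im = z₁.im + n * τ.im := by simp
    rw [hX, hY]
    set P : ℝ := z₁.re + n * τ.re + p with hP
    set Q : ℝ := z₁.im + n * τ.im with hQ
    have hn : (n : ℝ) ^ 2 ≤ 2 / τ.im ^ 2 * Q ^ 2 + 2 * z₁.im ^ 2 / τ.im ^ 2 := by
      have : (n : ℝ) ^ 2 = (Q - z₁.im) ^ 2 / τ.im ^ 2 := by rw [hQ]; field_simp; ring
      rw [this, div_mul_eq_mul_div, ← add_div]
      gcongr
      nlinarith [sq_nonneg (Q + z₁.im)]
    have hp : (p : ℝ) ^ 2 ≤ 3 * P ^ 2 + 3 * τ.re ^ 2 * n ^ 2 + 3 * z₁.re ^ 2 := by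
      have : (p : ℝ) = P - n * τ.re - z₁.re := by rw [hP]; ring
      rw [this]
      nlinarith [sq_nonneg (P + n * τ.re), sq_nonneg (P + z₁.re), sq_nonneg (n * τ.re - z₁.re)]
    have h3 : (1 + 3 * τ.re ^ 2) * (n : ℝ) ^ 2 ≤
        (1 + 3 * τ.re ^ 2) * (2 / τ.im ^ 2 * Q ^ 2 + 2 * z₁.im ^ 2 / τ.im ^ 2) := by
      gcongr
    have h4 : 0 ≤ (1 + 3 * τ.re ^ 2) * (2 / τ.im ^ 2) * P ^ 2 := by positivity
    rw [hK₁, hK₂]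
    linarith [sq_nonneg Q]
  set A : ℝ := Real.pi * m / τ.im with hA
  have hApos : 0 < A := by positivity
  set B : ℝ := A / K₁ with hB
  have hBpos : 0 < B := by positivity
  have hg1 : Summable fun n : ℤ => Real.exp (-(B * n ^ 2)) := by
    simpa using summable_exp_quadratic hBpos 0 0
  have hg : Summable fun v : ℤ × ℤ => Real.exp (-(B * v.1 ^ 2)) * Real.exp (-(B * v.2 ^ 2)) :=
    hg1.mul_of_nonneg hg1 (fun _ => (Real.exp_pos _).le) (fun _ => (Real.exp_pos _).le)
  set C : ℝ := Real.exp (-(2 * Real.pi * m * z₁.im * (z₁.im - (z₁ + z₂).im) / τ.im)) with hC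
  refine Summable.of_norm_bounded_eventually (hg.mul_left (C * Real.exp (B * K₂))) ?_
  -- This threshold forces `n² + p² > K₁ + K₂`, hence `‖X‖ > 1`, so that the denominator can be
  -- dropped.
  have hcof := hg.tendsto_cofinite_zero.eventually_lt_const (Real.exp_pos (-(B * (K₁ + K₂))))
  filter_upwards [hcof] with v hv
  rw [← Real.exp_add, Real.exp_lt_exp] at hv
  set X : ℂ := z₁ + v.1 * τ + v.2 with hX
  have hnorm : ‖X‖ ^ 2 = X.re ^ 2 + X.im ^ 2 := by
    rw [Complex.sq_norm, normSq_apply]; ring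
  have h1 := hK v.1 v.2
  rw [← hX, ← hnorm] at h1
  have hX1 : 1 ≤ ‖X‖ := by
    have h2 : K₁ + K₂ < (v.1 : ℝ) ^ 2 + v.2 ^ 2 := by
      by_contra hcon
      have := mul_le_mul_of_nonneg_left (not_lt.1 hcon) hBpos.le
      linarith
    have h3 : 1 < ‖X‖ ^ 2 := by
      by_contra hcon
      have := mul_le_mul_of_nonneg_left (not_lt.1 hcon) hK₁pos.le
      linarith
    nlinarith [norm_nonneg X]
  have hs : ‖e (-(s * v.2))‖ = 1 := by
    have : (-(s * v.2) : ℂ) = ((-(s * v.2) : ℝ) : ℂ) := by push_cast; rfl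
    rw [norm_e, this, ofReal_im]; simp
  rw [latticeTerm, norm_div, norm_mul, norm_mul, norm_signPow, hs, one_mul, one_mul,
    norm_e_latticeExponent m hτ, ← hX, ← hnorm, ← hC]
  refine (div_le_self (by positivity) hX1).trans ?_
  rw [mul_assoc]
  refine mul_le_mul_of_nonneg_left ?_ (by positivity)
  rw [← Real.exp_add, ← Real.exp_add]
  refine Real.exp_le_exp.2 ?_
  have h5 := mul_le_mul_of_nonneg_left h1 hBpos.le
  have h6 : B * K₁ = A := by rw [hB]; field_simp
  rw [← hA]
  have h7 : B * (K₁ * ‖X‖ ^ 2 + K₂) = A * ‖X‖ ^ 2 + B * K₂ := by rw [← h6]; ring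
  linarith

/-! ### From the rows to the expansion of `Φ̃` -/

/-- The sum over one row of the lattice. -/
theorem tsum_e_mul_gauss_div_twist {c : ℝ} (hc : 0 < c) (b s : ℝ) (z : ℂ)
    (hz : ∀ p : ℤ, z + p ≠ 0) :
    -(1 / (2 * Real.pi * I)) * ∑' p : ℤ, e (-(s * p)) *
      (e (b * (z + p)) * cexp (-(Real.pi * (z + p) ^ 2 / c)) / (z + p)) =
    e (s * z) / (1 - e z) - 1 / 2 * ∑' l : ℤ, e ((l + s) * z) *
      ((stepSign l - E ((l + s - b) * √c) : ℝ) : ℂ) := by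
  -- The twist `e(-sp)` is absorbed by replacing `b` with `b - s`, at the cost of a factor `e(sz)`.
  have h := tsum_e_mul_gauss_div hc (b - s) z hz
  have hL : ∑' p : ℤ, e (-(s * p)) *
      (e (b * (z + p)) * cexp (-(Real.pi * (z + p) ^ 2 / c)) / (z + p)) = e (s * z) *
      ∑' p : ℤ, e ((b - s : ℝ) * (z + p)) * cexp (-(Real.pi * (z + p) ^ 2 / c)) / (z + p) := by
    rw [← tsum_mul_left]
    refine tsum_congr fun p => ?_
    have : e (-(s * p)) * e (b * (z + p)) = e (s * z) * e ((b - s : ℝ) * (z + p)) := by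
      rw [← e_add, ← e_add]; congr 1; push_cast; ring
    rw [← mul_div_assoc, ← mul_div_assoc, ← mul_assoc, ← mul_assoc, this]
  have hR : ∑' l : ℤ, e ((l + s) * z) * ((stepSign l - E ((l + s - b) * √c) : ℝ) : ℂ) =
      e (s * z) * ∑' l : ℤ, e (l * z) * ((stepSign l - E ((l - (b - s)) * √c) : ℝ) : ℂ) := by
    rw [← tsum_mul_left]
    refine tsum_congr fun l => ?_
    rw [← mul_assoc, ← e_add, sub_sub_eq_add_sub]
    congr 2
    ring
  rw [hL, hR]
  linear_combination e (s * z) * h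

/-- The term of index `(n, l)` of the modifier, as a double series. -/
noncomputable def modifierTerm (ε : ℤˣ) (m s : ℝ) (τ z₁ z₂ : ℂ) (n l : ℤ) : ℂ :=
  signPow ε n * e (m * n * (z₁ + z₂) + m * n ^ 2 * τ) * (e ((l + s) * (z₁ + n * τ)) *
    ((stepSign l - E ((l + s - m * ((z₁ - z₂).im / τ.im)) * √(τ.im / m)) : ℝ) : ℂ))

theorem tsum_latticeTerm_row {m : ℝ} (hm : 0 < m) {τ : ℂ} (hτ : 0 < τ.im) (ε : ℤˣ) (s : ℝ)
    (z₁ z₂ : ℂ) (hz₁ : ∀ n p : ℤ, z₁ + n * τ + p ≠ 0) (n : ℤ) :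
    -(1 / (2 * Real.pi * I)) * ∑' p : ℤ, latticeTerm ε m s τ z₁ z₂ (n, p) =
      phiTerm ε m s τ z₁ z₂ n - 1 / 2 * ∑' l : ℤ, modifierTerm ε m s τ z₁ z₂ n l := by
  have hm0 : (m : ℂ) ≠ 0 := by exact_mod_cast hm.ne'
  have hy0 : (τ.im : ℂ) ≠ 0 := by exact_mod_cast hτ.ne'
  have h := tsum_e_mul_gauss_div_twist (div_pos hτ hm) (m * ((z₁ - z₂).im / τ.im)) s
    (z₁ + n * τ) (hz₁ n)
  have hL : ∑' p : ℤ, latticeTerm ε m s τ z₁ z₂ (n, p) =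
      signPow ε n * e (m * n * (z₁ + z₂) + m * n ^ 2 * τ) * ∑' p : ℤ, e (-(s * p)) *
        (e ((m * ((z₁ - z₂).im / τ.im) : ℝ) * (z₁ + n * τ + p)) *
          cexp (-(Real.pi * (z₁ + n * τ + p) ^ 2 / (τ.im / m : ℝ))) / (z₁ + n * τ + p)) := by
    rw [← tsum_mul_left]
    refine tsum_congr fun p => ?_
    have h1 : e (latticeExponent m τ z₁ z₂ n p) = e (m * n * (z₁ + z₂) + m * n ^ 2 * τ) *
        (e ((m * ((z₁ - z₂).im / τ.im) : ℝ) * (z₁ + n * τ + p)) *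
          cexp (-(Real.pi * (z₁ + n * τ + p) ^ 2 / (τ.im / m : ℝ)))) := by
      rw [latticeExponent]
      simp only [e, ← Complex.exp_add]
      congr 1
      push_cast
      field_simp
      ring_nf
      simp only [I_sq]
      ring
    simp only [latticeTerm]
    rw [h1]
    ring
  have hR : ∑' l : ℤ, modifierTerm ε m s τ z₁ z₂ n l =
      signPow ε n * e (m * n * (z₁ + z₂) + m * n ^ 2 * τ) *
        ∑' l : ℤ, e ((l + s) * (z₁ + n * τ)) * ((stepSign l -
          E ((l + s - m * ((z₁ - z₂).im / τ.im)) * √(τ.im / m)) : ℝ) : ℂ) := tsum_mul_left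
  have hΦ : phiTerm ε m s τ z₁ z₂ n = signPow ε n * e (m * n * (z₁ + z₂) + m * n ^ 2 * τ) *
      (e (s * (z₁ + n * τ)) / (1 - e (z₁ + n * τ))) := by
    have h2 : e (m * n * (z₁ + z₂) + m * n ^ 2 * τ) * e (s * (z₁ + n * τ)) =
        e (m * n * (z₁ + z₂) + s * z₁) * e ((m * (n : ℂ) ^ 2 + s * n) * τ) := by
      rw [← e_add, ← e_add]
      congr 1
      ring
    rw [phiTerm, ← h2, e_add z₁]
    ring
  rw [hL, hR, hΦ]
  linear_combination signPow ε n * e (m * n * (z₁ + z₂) + m * n ^ 2 * τ) * h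

/-- Put `λ = s + r + 2mk`. Completing the square, `mn² + λn = m(n + λ/2m)² - λ²/4m`, separates the
theta exponent, with index `n + k`, from the exponent of `R`; the signs match because `ε^k ε^k = 1`.
-/
theorem modifierTerm_eq_thetaTerm_mul_RTerm {m : ℝ} (hm : 0 < m) {N r : ℕ} (hN : 2 * m = N)
    (hr : r < N) (τ : ℂ) (ε : ℤˣ) (s : ℝ) (z₁ z₂ : ℂ) (n k : ℤ) :
    modifierTerm ε m s τ z₁ z₂ n (k * N + r) =
      RTerm ε (s + r) m τ ((z₁ - z₂) / 2) k * thetaTerm ε (s + r) m τ (z₁ + z₂) (n + k) := by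
  have hm0 : (m : ℂ) ≠ 0 := by exact_mod_cast hm.ne'
  have hN' : (N : ℂ) = 2 * m := by exact_mod_cast hN.symm
  have h1 : (((k * N + r : ℤ) : ℝ) + s - m * ((z₁ - z₂).im / τ.im)) * √(τ.im / m) =
      psi m (s + r + 2 * m * k) τ ((z₁ - z₂) / 2) := by
    have : ((z₁ - z₂) / 2).im = (z₁ - z₂).im / 2 := by
      rw [show (z₁ - z₂) / 2 = ((1 / 2 : ℝ) : ℂ) * (z₁ - z₂) by push_cast; ring, im_ofReal_mul]
      ring
    rw [psi, this]
    push_cast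
    linear_combination (-(k : ℝ) * √(τ.im / m)) * hN
  simp only [RTerm, thetaTerm]
  rw [sign_eq_stepSign (by omega) hN, ← h1, modifierTerm, stepSign_add_mul hr]
  have h2 : e (m * n * (z₁ + z₂) + m * n ^ 2 * τ) * e (((k * N + r : ℤ) + s) * (z₁ + n * τ)) =
      cexp (-(Real.pi * I * (s + r + 2 * m * k : ℝ) ^ 2 / (2 * m)) * τ +
        2 * Real.pi * I * (s + r + 2 * m * k : ℝ) * ((z₁ - z₂) / 2)) *
      (e (m * (z₁ + z₂) * ((n + k : ℤ) + (s + r : ℝ) / (2 * m))) *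
        e (m * ((n + k : ℤ) + (s + r : ℝ) / (2 * m)) ^ 2 * τ)) := by
    simp only [e, ← Complex.exp_add]
    congr 1
    push_cast
    rw [hN']
    field_simp
    ring
  rw [signPow_add]
  have h3 := signPow_mul_self ε k
  linear_combination (signPow ε n *
    ((stepSign k - E ((((k * N + r : ℤ) : ℝ) + s - m * ((z₁ - z₂).im / τ.im)) * √(τ.im / m)) : ℝ)
      : ℂ)) * h2 - signPow ε n *
    ((stepSign k - E ((((k * N + r : ℤ) : ℝ) + s - m * ((z₁ - z₂).im / τ.im)) * √(τ.im / m)) : ℝ)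
      : ℂ) * (cexp (-(Real.pi * I * (s + r + 2 * m * k : ℝ) ^ 2 / (2 * m)) * τ +
        2 * Real.pi * I * (s + r + 2 * m * k : ℝ) * ((z₁ - z₂) / 2)) *
      (e (m * (z₁ + z₂) * ((n + k : ℤ) + (s + r : ℝ) / (2 * m))) *
        e (m * ((n + k : ℤ) + (s + r : ℝ) / (2 * m)) ^ 2 * τ))) * h3

theorem hasSum_modifierTerm {m : ℝ} (hm : 0 < m) {N : ℕ} (hN : 2 * m = N) {τ : ℂ}
    (hτ : 0 < τ.im) (ε : ℤˣ) (s : ℝ) (z₁ z₂ : ℂ) :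
    HasSum (fun n => ∑' l : ℤ, modifierTerm ε m s τ z₁ z₂ n l) (PhiAdd ε m s τ z₁ z₂) := by
  have hN0 : 0 < N := by
    have : (0 : ℝ) < N := by linarith
    exact_mod_cast this
  have : NeZero N := ⟨hN0.ne'⟩
  have hprod : ∀ r : Fin N, HasSum
      (fun v : ℤ × ℤ => modifierTerm ε m s τ z₁ z₂ v.1 (v.2 * N + (r : ℕ)))
      (R ε (s + (r : ℕ)) m τ ((z₁ - z₂) / 2) * Theta ε (s + (r : ℕ)) m τ (z₁ + z₂)) := by
    intro r
    have hR := summable_RTerm hm hN hτ ε (s + (r : ℕ)) ((z₁ - z₂) / 2)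
    have hΘ := summable_thetaTerm hm hτ ε (s + (r : ℕ)) (z₁ + z₂)
    have h := hR.hasSum.mul hΘ.hasSum (summable_mul_of_summable_norm hR.norm hΘ.norm)
    -- The pair `(n, k)` goes to the index `k` of `R` and the index `n + k` of `Θ`.
    let φ : ℤ × ℤ ≃ ℤ × ℤ :=
      { toFun := fun v => (v.2, v.1 + v.2)
        invFun := fun v => (v.2 - v.1, v.1)
        left_inv := fun v => by simp
        right_inv := fun v => by simp }
    refine (φ.hasSum_iff.2 h).congr_fun ?_
    intro v
    exact modifierTerm_eq_thetaTerm_mul_RTerm hm hN r.2 τ ε s z₁ z₂ v.1 v.2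
  have hrow : ∀ n : ℤ, ∑' l : ℤ, modifierTerm ε m s τ z₁ z₂ n l =
      ∑ r : Fin N, ∑' k : ℤ, modifierTerm ε m s τ z₁ z₂ n (k * N + (r : ℕ)) := by
    intro n
    have hs : Summable fun l : ℤ => modifierTerm ε m s τ z₁ z₂ n l := by
      refine Summable.mul_left _ ?_
      have := summable_e_mul_stepSign_sub_E (div_pos hτ hm)
        (m * ((z₁ - z₂).im / τ.im) - s) s (z₁ + n * τ)
      simpa only [sub_sub_eq_add_sub] using this
    rw [← (Int.divModEquiv N).symm.tsum_eq, ← (Equiv.prodComm _ _).tsum_eq]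
    rw [Summable.tsum_prod, tsum_fintype]
    · rfl
    · exact (Equiv.prodComm _ _).summable_iff.2 ((Int.divModEquiv N).symm.summable_iff.2 hs)
  simp only [hrow]
  have hceil : ⌈2 * m⌉₊ = N := by rw [hN, Nat.ceil_natCast]
  rw [PhiAdd, hceil, ← Fin.sum_univ_eq_sum_range
    (fun k => R ε (s + k) m τ ((z₁ - z₂) / 2) * Theta ε (s + k) m τ (z₁ + z₂))]
  exact hasSum_sum fun r _ => (hprod r).prod_fiberwise fun n =>
    ((hprod r).summable.prod_factor n).hasSum

/-- The expansion of `Φ̃` as an absolutely convergent series over the lattice `ℤτ + ℤ`. -/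
theorem PhiMod_eq_tsum_latticeTerm {m : ℝ} (hm : 0 < m) {N : ℕ} (hN : 2 * m = N) {τ : ℂ}
    (hτ : 0 < τ.im) (ε : ℤˣ) (s : ℝ) (z₁ z₂ : ℂ) (hz₁ : ∀ n p : ℤ, z₁ + n * τ + p ≠ 0) :
    PhiMod ε m s τ z₁ z₂ =
      -(1 / (2 * Real.pi * I)) * ∑' v : ℤ × ℤ, latticeTerm ε m s τ z₁ z₂ v := by
  rw [(summable_latticeTerm hm hτ ε s z₁ z₂).tsum_prod, ← tsum_mul_left,
    tsum_congr (tsum_latticeTerm_row hm hτ ε s z₁ z₂ hz₁)]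
  exact ((summable_phiTerm hm hτ ε s z₁ z₂).hasSum.sub
    ((hasSum_modifierTerm hm hN hτ ε s z₁ z₂).mul_left (1 / 2))).tsum_eq.symm

/-! ### Transformations as relabellings of the lattice -/

theorem latticeExponent_inversion (m : ℝ) {N : ℕ} (hN : 2 * m = N) {τ : ℂ} (hτ : 0 < τ.im)
    (z₁ z₂ : ℂ) (n p : ℤ) :
    latticeExponent m (-1 / τ) (z₁ / τ) (z₂ / τ) n p =
      m / τ * z₁ * z₂ + latticeExponent m τ z₁ z₂ p (-n) + (-(N * n * p) : ℤ) := by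
  have hτ0 : τ ≠ 0 := by rintro rfl; simp at hτ
  have hy0 : (τ.im : ℂ) ≠ 0 := by exact_mod_cast hτ.ne'
  have hns : normSq τ ≠ 0 := by simpa using hτ0
  have him : (-1 / τ).im = τ.im / normSq τ := by
    rw [neg_div, neg_im, one_div, inv_im]; ring
  have hτre : τ = τ.re + τ.im * I := (re_add_im τ).symm
  have h1 : (((z₁ / τ - z₂ / τ).im / (-1 / τ).im : ℝ) : ℂ) =
      ((z₁ - z₂).im / τ.im : ℝ) * τ - (z₁ - z₂) := by
    rw [← sub_div, him, div_im]
    have h2 : ((z₁ - z₂).im * τ.re / normSq τ - (z₁ - z₂).re * τ.im / normSq τ) /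
        (τ.im / normSq τ) = (z₁ - z₂).im / τ.im * τ.re - (z₁ - z₂).re := by
      field_simp
    rw [h2]
    have h3 := re_add_im (z₁ - z₂)
    have h7 : (((z₁ - z₂).im / τ.im * τ.re - (z₁ - z₂).re : ℝ) : ℂ) =
        ((z₁ - z₂).im / τ.im : ℝ) * (τ.re + τ.im * I) - ((z₁ - z₂).re + (z₁ - z₂).im * I) := by
      push_cast
      field_simp
      ring
    rw [h7, h3, ← hτre]
  have h4 : I * m / (2 * (-1 / τ).im) = m * (I / (2 * τ.im) * τ ^ 2 + τ) := by
    have h5 : ((normSq τ : ℝ) : ℂ) = τ * (τ - 2 * τ.im * I) := by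
      have h8 : (starRingEnd ℂ) τ = τ - 2 * τ.im * I := by
        apply Complex.ext
        · simp
        · simp
          ring
      rw [← mul_conj, h8]
    have hns' : ((normSq τ : ℝ) : ℂ) ≠ 0 := by exact_mod_cast hns
    rw [him]
    push_cast
    have h6 : I * m / (2 * (τ.im / (normSq τ : ℂ))) = I * m / (2 * τ.im) * (normSq τ : ℂ) := by
      field_simp
    rw [h6, h5]
    field_simp
    ring_nf
    simp only [I_sq]
    ring
  have hN' : (N : ℂ) = 2 * m := by exact_mod_cast hN.symm
  rw [latticeExponent, latticeExponent, h1, h4]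
  -- After `h1` and `h4` all non-holomorphic dependence sits in `d` and `τ.im`, and the claim is an
  -- identity of rational functions.
  generalize (((z₁ - z₂).im / τ.im : ℝ) : ℂ) = d
  push_cast
  rw [hN']
  field_simp
  ring

/-- The relabelling `(n, p) ↦ (p, -n)` exchanges the sign in `n` with the character in `p`; the
factor `τ` comes from the denominators. -/
theorem PhiMod_inversion {m : ℝ} (hm : 0 < m) {N : ℕ} (hN : 2 * m = N) {τ : ℂ} (hτ : 0 < τ.im)
    {ε χ : ℤˣ} {s s' : ℝ} (hs : ∀ p : ℤ, e (-(s * p)) = signPow χ p)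
    (hs' : ∀ p : ℤ, e (-(s' * p)) = signPow ε p) (z₁ z₂ : ℂ)
    (hz₁ : ∀ n p : ℤ, z₁ + n * τ + p ≠ 0) :
    PhiMod ε m s (-1 / τ) (z₁ / τ) (z₂ / τ) =
      τ * e (m / τ * z₁ * z₂) * PhiMod χ m s' τ z₁ z₂ := by
  have hτ0 : τ ≠ 0 := by rintro rfl; simp at hτ
  have hX : ∀ n p : ℤ, z₁ / τ + n * (-1 / τ) + p = (z₁ + p * τ + (-n : ℤ)) / τ := by
    intro n p
    push_cast
    field_simp
    ring
  have him : 0 < (-1 / τ).im := by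
    rw [neg_div, neg_im, one_div, inv_im, neg_div, neg_neg]
    exact div_pos hτ (normSq_pos.2 hτ0)
  let φ : ℤ × ℤ ≃ ℤ × ℤ :=
    { toFun := fun v => (v.2, -v.1)
      invFun := fun v => (-v.2, v.1)
      left_inv := fun v => by simp
      right_inv := fun v => by simp }
  rw [PhiMod_eq_tsum_latticeTerm hm hN him ε s _ _ fun n p => by
      rw [hX]; exact div_ne_zero (hz₁ _ _) hτ0,
    PhiMod_eq_tsum_latticeTerm hm hN hτ χ s' _ _ hz₁, mul_left_comm]
  congr 1
  rw [← tsum_mul_left]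
  refine Eq.trans ?_ (φ.tsum_eq _)
  refine tsum_congr fun v => ?_
  simp only [latticeTerm, φ, Equiv.coe_fn_mk]
  rw [hX, hs, hs', latticeExponent_inversion m hN hτ, e_eq_of_eq_add_int _ rfl, e_add, signPow_neg]
  have := hz₁ v.2 (-v.1)
  field_simp

theorem PhiMod_add_one {m : ℝ} (hm : 0 < m) {N : ℕ} (hN : 2 * m = N) {τ : ℂ} (hτ : 0 < τ.im)
    {ε δ : ℤˣ} {s : ℝ}
    (h : ∀ n : ℤ, signPow ε n * e (m * n ^ 2 + s * n) = signPow δ n) (z₁ z₂ : ℂ)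
    (hz₁ : ∀ n p : ℤ, z₁ + n * τ + p ≠ 0) :
    PhiMod ε m s (τ + 1) z₁ z₂ = PhiMod δ m s τ z₁ z₂ := by
  have hX : ∀ n p : ℤ, z₁ + n * (τ + 1) + p = z₁ + n * τ + (n + p : ℤ) := by
    intro n p
    push_cast
    ring
  have him : (τ + 1).im = τ.im := by simp
  let φ : ℤ × ℤ ≃ ℤ × ℤ :=
    { toFun := fun v => (v.1, v.1 + v.2)
      invFun := fun v => (v.1, v.2 - v.1)
      left_inv := fun v => by simp
      right_inv := fun v => by simp }
  rw [PhiMod_eq_tsum_latticeTerm hm hN (him ▸ hτ) ε s _ _ fun n p => by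
      rw [hX]; exact hz₁ _ _,
    PhiMod_eq_tsum_latticeTerm hm hN hτ δ s _ _ hz₁]
  congr 1
  refine Eq.trans ?_ (φ.tsum_eq _)
  refine tsum_congr fun v => ?_
  have h1 : e (-(s * v.2)) * e (latticeExponent m (τ + 1) z₁ z₂ v.1 v.2) =
      e (m * v.1 ^ 2 + s * v.1) *
        (e (-(s * (v.1 + v.2 : ℤ))) * e (latticeExponent m τ z₁ z₂ v.1 (v.1 + v.2))) := by
    simp only [← e_add]
    congr 1
    rw [latticeExponent, latticeExponent, hX, him]
    push_cast
    ring
  simp only [latticeTerm, φ, Equiv.coe_fn_mk]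
  rw [hX, ← h, mul_assoc (signPow ε v.1), h1]
  ring

/-- Shifting `n` by `a` restores the denominators; the remaining phase in `p` is `e(m(a - b)p)`,
which can change `s` to `s'`. -/
theorem PhiMod_add_mul {m : ℝ} (hm : 0 < m) {N : ℕ} (hN : 2 * m = N) {τ : ℂ} (hτ : 0 < τ.im)
    (ε : ℤˣ) {s s' : ℝ} {a b : ℤ} (h : ∀ p : ℤ, e ((m * (a - b) - s) * p) = e (-(s' * p)))
    (z₁ z₂ : ℂ) (hz₁ : ∀ n p : ℤ, z₁ + n * τ + p ≠ 0) :
    PhiMod ε m s τ (z₁ + a * τ) (z₂ + b * τ) =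
      signPow ε a * e (-(m * (b * z₁ + a * z₂))) * e (-(m * a * b) * τ) *
        PhiMod ε m s' τ z₁ z₂ := by
  have hX : ∀ n p : ℤ, z₁ + a * τ + n * τ + p = z₁ + (n + a : ℤ) * τ + p := by
    intro n p
    push_cast
    ring
  have hy0 : (τ.im : ℂ) ≠ 0 := by exact_mod_cast hτ.ne'
  have him : (((z₁ + a * τ - (z₂ + b * τ)).im / τ.im : ℝ) : ℂ) =
      ((z₁ - z₂).im / τ.im : ℝ) + a - b := by
    simp
    field_simp
    ring
  rw [PhiMod_eq_tsum_latticeTerm hm hN hτ ε s _ _ fun n p => by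
      rw [hX]; exact hz₁ _ _,
    PhiMod_eq_tsum_latticeTerm hm hN hτ ε s' _ _ hz₁, mul_left_comm]
  congr 1
  rw [← tsum_mul_left]
  refine Eq.trans ?_ (((Equiv.addRight a).prodCongr (Equiv.refl ℤ)).tsum_eq _)
  refine tsum_congr fun v => ?_
  have h1 : e (-(s * v.2)) * e (latticeExponent m τ (z₁ + a * τ) (z₂ + b * τ) v.1 v.2) =
      e ((m * (a - b) - s) * v.2) * (e (-(m * (b * z₁ + a * z₂))) * e (-(m * a * b) * τ) *
        e (latticeExponent m τ z₁ z₂ (v.1 + a) v.2)) := by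
    simp only [← e_add]
    congr 1
    rw [latticeExponent, latticeExponent, hX, him]
    push_cast
    ring
  simp only [latticeTerm, Equiv.prodCongr_apply, Prod.map, Equiv.coe_addRight, Equiv.refl_apply]
  rw [hX, signPow_add, mul_assoc (signPow ε v.1), h1, h]
  linear_combination (-(signPow ε v.1 * (e (-(s' * v.2)) *
    (e (-(m * (b * z₁ + a * z₂))) * e (-(m * a * b) * τ) *
        e (latticeExponent m τ z₁ z₂ (v.1 + a) v.2))) / (z₁ + (v.1 + a : ℤ) * τ + v.2))) *
    signPow_mul_self ε a

/-- Shifting `p` by `a` leaves the phase `e(m(a + b)n)`, which can change the sign character. -/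
theorem PhiMod_add_int {m : ℝ} (hm : 0 < m) {N : ℕ} (hN : 2 * m = N) {τ : ℂ} (hτ : 0 < τ.im)
    {ε δ : ℤˣ} (s : ℝ) {a b : ℤ}
    (h : ∀ n : ℤ, signPow ε n * e (m * (a + b) * n) = signPow δ n)
    (z₁ z₂ : ℂ) (hz₁ : ∀ n p : ℤ, z₁ + n * τ + p ≠ 0) :
    PhiMod ε m s τ (z₁ + a) (z₂ + b) = e (s * a) * PhiMod δ m s τ z₁ z₂ := by
  have hX : ∀ n p : ℤ, z₁ + a + n * τ + p = z₁ + n * τ + (p + a : ℤ) := by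
    intro n p
    push_cast
    ring
  have him : (z₁ + a - (z₂ + b)).im = (z₁ - z₂).im := by simp
  rw [PhiMod_eq_tsum_latticeTerm hm hN hτ ε s _ _ fun n p => by
      rw [hX]; exact hz₁ _ _,
    PhiMod_eq_tsum_latticeTerm hm hN hτ δ s _ _ hz₁, mul_left_comm]
  congr 1
  rw [← tsum_mul_left]
  refine Eq.trans ?_ (((Equiv.refl ℤ).prodCongr (Equiv.addRight a)).tsum_eq _)
  refine tsum_congr fun v => ?_
  have h1 : e (-(s * v.2)) * e (latticeExponent m τ (z₁ + a) (z₂ + b) v.1 v.2) =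
      e (m * (a + b) * v.1) * (e (s * a) * (e (-(s * (v.2 + a : ℤ))) *
        e (latticeExponent m τ z₁ z₂ v.1 (v.2 + a)))) := by
    simp only [← e_add]
    congr 1
    rw [latticeExponent, latticeExponent, hX, him]
    push_cast
    ring
  simp only [latticeTerm, Equiv.prodCongr_apply, Prod.map, Equiv.coe_addRight, Equiv.refl_apply]
  rw [hX, ← h, mul_assoc (signPow ε v.1), h1]
  ring

/-! ### Integrality and parity -/

theorem e_neg_mul_of_isInt {s : ℝ} (hs : IsInt s) (p : ℤ) : e (-(s * p)) = signPow 1 p := by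
  obtain ⟨k, rfl⟩ := hs
  rw [signPow_one, ← e_int (-(k * p))]
  push_cast
  rfl

theorem e_neg_mul_of_isHalfOdd {s : ℝ} (hs : IsHalfOdd s) (p : ℤ) :
    e (-(s * p)) = signPow (-1) p := by
  obtain ⟨k, rfl⟩ := hs
  rw [← signPow_neg, ← e_half]
  refine e_eq_of_eq_add_int (-(k * p)) ?_
  push_cast
  ring

/-- As `n(n - 1)` is even, the phase `mn² + sn` of `τ ↦ τ + 1` reduces modulo `1` to `(m + s)n`. -/
theorem exists_mul_sq {m : ℝ} {N : ℕ} (hN : 2 * m = N) (n : ℤ) :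
    ∃ k : ℤ, (m * n ^ 2 : ℂ) = m * n + k := by
  obtain ⟨k, hk⟩ := (Int.even_mul_pred_self n)
  have hN' : (2 * m : ℂ) = N := by exact_mod_cast hN
  have hk' : (n * (n - 1) : ℂ) = k + k := by exact_mod_cast hk
  refine ⟨N * k, ?_⟩
  push_cast
  linear_combination (m : ℂ) * hk' + k * hN'

theorem isHalfOdd_of_not_isInt {m : ℝ} (hm : IsHalfInt m) (h : ¬ IsInt m) : IsHalfOdd m := by
  obtain ⟨k, rfl⟩ := hm
  rcases Int.even_or_odd' k with ⟨c, rfl | rfl⟩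
  · exact absurd ⟨c, by push_cast; ring⟩ h
  · exact ⟨c, by push_cast; ring⟩

theorem isInt_mul_of_even {m : ℝ} {N : ℕ} (hN : 2 * m = N) {a : ℤ} (ha : Even a) :
    IsInt (m * a) := by
  obtain ⟨c, rfl⟩ := ha
  refine ⟨N * c, ?_⟩
  push_cast
  linear_combination (c : ℝ) * hN

theorem isHalfOdd_mul_of_odd {m : ℝ} (hm : IsHalfOdd m) {a : ℤ} (ha : Odd a) :
    IsHalfOdd (m * a) := by
  obtain ⟨k, rfl⟩ := hm
  obtain ⟨c, rfl⟩ := ha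
  refine ⟨k * (2 * c + 1) + c, ?_⟩
  push_cast
  ring

end MockTheta

theorem theorem1p3 (m : ℝ) (hm_pos : 0 < m) (hm : MockTheta.IsHalfInt m)
    (τ z₁ z₂ : ℂ) (hτ : 0 < τ.im) (hz₁ : ∀ p r : ℤ, z₁ ≠ p + r * τ) :
    -- all the series in the definition converge absolutely
    (∀ (ε : ℤˣ) (s : ℝ), MockTheta.IsHalfInt s →
      Summable (MockTheta.phiTerm ε m s τ z₁ z₂) ∧
      (∀ z : ℂ, Summable (MockTheta.thetaTerm ε s m τ z)) ∧
      (∀ z : ℂ, Summable (MockTheta.RTerm ε s m τ z))) ∧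
    -- (a)
    (∀ s s₁ s' s₁' : ℝ, MockTheta.IsInt s → MockTheta.IsInt s₁ →
      MockTheta.IsHalfOdd s' → MockTheta.IsHalfOdd s₁' →
      MockTheta.PhiMod 1 m s (-1 / τ) (z₁ / τ) (z₂ / τ) =
        τ * MockTheta.e (m / τ * z₁ * z₂) * MockTheta.PhiMod 1 m s₁ τ z₁ z₂ ∧
      MockTheta.PhiMod (-1) m s (-1 / τ) (z₁ / τ) (z₂ / τ) =
        τ * MockTheta.e (m / τ * z₁ * z₂) * MockTheta.PhiMod 1 m s' τ z₁ z₂ ∧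
      MockTheta.PhiMod 1 m s' (-1 / τ) (z₁ / τ) (z₂ / τ) =
        τ * MockTheta.e (m / τ * z₁ * z₂) * MockTheta.PhiMod (-1) m s τ z₁ z₂ ∧
      MockTheta.PhiMod (-1) m s' (-1 / τ) (z₁ / τ) (z₂ / τ) =
        τ * MockTheta.e (m / τ * z₁ * z₂) * MockTheta.PhiMod (-1) m s₁' τ z₁ z₂) ∧
    -- (b)
    (∀ (ε : ℤˣ) (s s' : ℝ), MockTheta.IsHalfInt s → MockTheta.IsHalfInt s' →
      MockTheta.IsInt (m + s) → MockTheta.IsHalfOdd (m + s') →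
      MockTheta.PhiMod ε m s (τ + 1) z₁ z₂ = MockTheta.PhiMod ε m s τ z₁ z₂ ∧
      MockTheta.PhiMod ε m s' (τ + 1) z₁ z₂ = MockTheta.PhiMod (-ε) m s' τ z₁ z₂) ∧
    -- (c)
    (∀ (ε : ℤˣ) (s : ℝ) (a b : ℤ), MockTheta.IsHalfInt s →
      (a ≡ b [ZMOD 2] ∨ MockTheta.IsInt m) →
      MockTheta.PhiMod ε m s τ (z₁ + a * τ) (z₂ + b * τ) =
        MockTheta.signPow ε a * MockTheta.e (-(m * (b * z₁ + a * z₂))) *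
          MockTheta.e (-(m * a * b) * τ) * MockTheta.PhiMod ε m s τ z₁ z₂ ∧
      MockTheta.PhiMod ε m s τ (z₁ + a) (z₂ + b) =
        MockTheta.e (s * a) * MockTheta.PhiMod ε m s τ z₁ z₂) ∧
    -- (d)
    (¬ MockTheta.IsInt m →
      ∀ (ε : ℤˣ) (s : ℝ) (a b : ℤ), MockTheta.IsHalfInt s → ¬ a ≡ b [ZMOD 2] →
      MockTheta.PhiMod ε m s τ (z₁ + a * τ) (z₂ + b * τ) =
        MockTheta.signPow ε a * MockTheta.e (-(m * (b * z₁ + a * z₂))) *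
          MockTheta.e (-(m * a * b) * τ) * MockTheta.PhiMod ε m (s + 1 / 2) τ z₁ z₂ ∧
      MockTheta.PhiMod ε m s τ (z₁ + a) (z₂ + b) =
        MockTheta.e (s * a) * MockTheta.PhiMod (-ε) m s τ z₁ z₂) := by

  obtain ⟨N, hN⟩ : ∃ N : ℕ, 2 * m = N := by
    obtain ⟨k, hk⟩ := hm
    have hk0 : 0 ≤ k := by
      have : (0 : ℝ) < k := by linarith
      exact_mod_cast this.le
    refine ⟨k.toNat, ?_⟩
    have : ((k.toNat : ℤ) : ℝ) = k := by rw [Int.toNat_of_nonneg hk0]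
    rw [Int.cast_natCast] at this
    rw [this, hk]
    ring
  have hz : ∀ n p : ℤ, z₁ + n * τ + p ≠ 0 := by
    intro n p h
    refine hz₁ (-p) (-n) ?_
    push_cast
    linear_combination h
  open MockTheta in
  refine ⟨fun ε s _ => ⟨summable_phiTerm hm_pos hτ ε s z₁ z₂,
    fun z => summable_thetaTerm hm_pos hτ ε s z, fun z => summable_RTerm hm_pos hN hτ ε s z⟩,
    ?_, ?_, ?_, ?_⟩
  · intro s s₁ s' s₁' hs hs₁ hs' hs₁'
    have h := e_neg_mul_of_isInt hs
    have h₁ := e_neg_mul_of_isInt hs₁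
    have h' := e_neg_mul_of_isHalfOdd hs'
    have h₁' := e_neg_mul_of_isHalfOdd hs₁'
    exact ⟨PhiMod_inversion hm_pos hN hτ h h₁ z₁ z₂ hz, PhiMod_inversion hm_pos hN hτ h h' z₁ z₂ hz,
      PhiMod_inversion hm_pos hN hτ h' h z₁ z₂ hz, PhiMod_inversion hm_pos hN hτ h' h₁' z₁ z₂ hz⟩
  · intro ε s s' _ _ hs hs'
    constructor
    · refine PhiMod_add_one hm_pos hN hτ (fun n => ?_) z₁ z₂ hz
      obtain ⟨k, hk⟩ := exists_mul_sq hN n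
      obtain ⟨l, hl⟩ := hs
      have hl' : (m + s : ℂ) = l := by exact_mod_cast hl
      have : (m * n ^ 2 + s * n : ℂ) = (l * n + k : ℤ) := by
        push_cast
        linear_combination hk + (n : ℂ) * hl'
      rw [this, e_int, mul_one]
    · refine PhiMod_add_one hm_pos hN hτ (fun n => ?_) z₁ z₂ hz
      obtain ⟨k, hk⟩ := exists_mul_sq hN n
      obtain ⟨l, hl⟩ := hs'
      have hl' : (m + s' : ℂ) = 1 / 2 + l := by
        have := congrArg (fun x : ℝ => (x : ℂ)) hl
        push_cast at this
        exact this
      have : (m * n ^ 2 + s' * n : ℂ) = n / 2 + (l * n + k : ℤ) := by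
        push_cast
        linear_combination hk + (n : ℂ) * hl'
      rw [e_eq_of_eq_add_int _ this, e_half, ← signPow_mul, mul_neg_one]
  · intro ε s a b _ hab
    have hint : ∀ c : ℤ, (Even c ↔ Even (a + b)) → IsInt (m * c) := by
      intro c hc
      rcases hab with hab | hm'
      · refine isInt_mul_of_even hN (hc.2 ?_)
        rw [Int.even_iff]
        unfold Int.ModEq at hab
        omega
      · obtain ⟨k, rfl⟩ := hm'
        exact ⟨k * c, by push_cast; ring⟩
    constructor
    · refine PhiMod_add_mul hm_pos hN hτ ε (fun p => ?_) z₁ z₂ hz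
      obtain ⟨k, hk⟩ := hint (a - b) (by rw [Int.even_sub, Int.even_add])
      have hk' : (m * (a - b) : ℂ) = k := by
        exact_mod_cast congrArg (fun x : ℝ => (x : ℂ)) hk
      refine e_eq_of_eq_add_int (k * p) ?_
      push_cast
      linear_combination (p : ℂ) * hk'
    · refine PhiMod_add_int hm_pos hN hτ s (fun n => ?_) z₁ z₂ hz
      obtain ⟨k, hk⟩ := hint (a + b) Iff.rfl
      have hk' : (m * (a + b) : ℂ) = k := by
        exact_mod_cast congrArg (fun x : ℝ => (x : ℂ)) hk
      have : (m * (a + b) * n : ℂ) = (k * n : ℤ) := by rw [hk']; push_cast; rfl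
      rw [this, e_int, mul_one]
  · intro hm' ε s a b _ hab
    have hodd : Odd (a + b) := by
      rw [Int.odd_iff]
      unfold Int.ModEq at hab
      omega
    have hmo := isHalfOdd_of_not_isInt hm hm'
    constructor
    · refine PhiMod_add_mul hm_pos hN hτ ε (fun p => ?_) z₁ z₂ hz
      obtain ⟨k, hk⟩ := isHalfOdd_mul_of_odd hmo
        (show Odd (a - b) by rw [Int.odd_sub, ← Int.odd_add]; exact hodd)
      have hk' : (m * (a - b) : ℂ) = 1 / 2 + k := by
        have := congrArg (fun x : ℝ => (x : ℂ)) hk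
        push_cast at this
        exact this
      -- Passing from `-s` to `-(s + 1/2)` adds a second half to `m(a - b) = 1/2 + k`, hence `k +
      -- 1`.
      refine e_eq_of_eq_add_int ((k + 1) * p) ?_
      push_cast
      linear_combination (p : ℂ) * hk'
    · refine PhiMod_add_int hm_pos hN hτ s (fun n => ?_) z₁ z₂ hz
      obtain ⟨k, hk⟩ := isHalfOdd_mul_of_odd hmo hodd
      have hk' : (m * (a + b) : ℂ) = 1 / 2 + k := by
        have := congrArg (fun x : ℝ => (x : ℂ)) hk
        push_cast at this
        exact this
      have : (m * (a + b) * n : ℂ) = n / 2 + (k * n : ℤ) := by rw [hk']; push_cast; ring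
      rw [e_eq_of_eq_add_int _ this, e_half, ← signPow_mul, mul_neg_one]
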